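/- Let $V$ be a Banach space over $\mathbb{K}=\mathbb{R}$ or $\mathbb{C}$ and let $(W_r)_{r\in\mathbb{N}}$ be a family of linear subspaces of $V$ such that $\bigcup_{r\in\mathbb{N}}W_r$ is a linear subspace of $V$ of infinite codimension. Suppose that for each $r\in\mathbb{N}$ there exist a norm $\|\cdot\|_{W_r}$ on $W_r$ and a constant $C_r>0$ such that $(W_r,\|\cdot\|_{W_r})$ is a Banach space and $\|x\|_V\le C_r\|x\|_{W_r}$ for all $x\in W_r$. Put $A:=V\smallsetminus\bigcup_{r\in\mathbb{N}}W_r$ and let $\mathfrak{c}$ be the cardinality of $\mathbb{R}$. Then for every cardinal $\alpha<\aleph_0$ the set $A$ is $(\alpha,\mathfrak{c})$-spaceable, that is: (i) there is a subspace $F$ of $V$ with $\dim F=\alpha$ and $F\smallsetminus\{0\}\subset A$; and (ii) for every subspace $F_\alpha$ of $V$ with $\dim F_\alpha=\alpha$ and $F_\alpha\subset A\cup\{0\}$ there is a closed subspace $F_{\mathfrak{c}}$ of $V$ with $\dim F_{\mathfrak{c}}=\mathfrak{c}$ and $F_\alpha\subset F_{\mathfrak{c}}\subset A\cup\{0\}$.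 Here $\dim$ denotes the algebraic (Hamel) dimension over $\mathbb{K}$. -/

import Mathlib

/-- `A ⊆ E` is `β`-lineable: some `β`-dimensional subspace `F` of `E` has `F ∖ {0} ⊆ A`. -/
def IsLineable (K : Type*) {E : Type*} [Field K] [AddCommGroup E] [Module K E]
    (β : Cardinal) (A : Set E) : Prop :=
  ∃ F : Submodule K E, Module.rank K F = β ∧ (F : Set E) \ {0} ⊆ A

/-- `A ⊆ E` is `(α, β)`-spaceable: it is `α`-lineable, and every `α`-dimensional subspace contained
in `A ∪ {0}` is contained in a closed `β`-dimensional subspace that is contained in `A ∪ {0}`.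
(The notion is meant for cardinals `α < β ≤ dim E`; that `β ≤ dim E` follows from the two
clauses.) -/
def IsPairSpaceable (K : Type*) {E : Type*} [Field K] [AddCommGroup E] [Module K E]
    [TopologicalSpace E] (α β : Cardinal) (A : Set E) : Prop :=
  IsLineable K α A ∧
    ∀ Fα : Submodule K E, Module.rank K Fα = α → (Fα : Set E) ⊆ A ∪ {0} →
      ∃ Fβ : Submodule K E, Module.rank K Fβ = β ∧ IsClosed (Fβ : Set E) ∧
        Fα ≤ Fβ ∧ (Fβ : Set E) ⊆ A ∪ {0}

/-- The seminorm `p` is a norm on `E`, and `(E, p)` is complete, i.e. a Banach space. -/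
def IsBanachNorm {𝕜 E : Type*} [RCLike 𝕜] [AddCommGroup E] [Module 𝕜 E]
    (p : Seminorm 𝕜 E) : Prop :=
  (∀ x, p x = 0 → x = 0) ∧
    letI : SeminormedAddCommGroup E := p.toAddGroupSeminorm.toSeminormedAddCommGroup
    CompleteSpace E

/-! Each `W r` is the range of a bounded operator `T r` on a Banach space. Its `dualSpan` relative
to a finite-dimensional `G` is a countable union of closed sets; Baire and the open mapping argument
make it proper when the range has infinite codimension (`range_sup_eq_top_of_dualSpan_eq_top`).

Baire again gives vectors outside all these spans, and `mem_dualSpan_exchange` keeps earlier vectors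
independent. The resulting sequence has coordinate functionals that can be chosen arbitrarily small
on any `T r` (`exists_seq_biorthogonal`). All choices agree on the closed span of the sequence, so a
point of that span in a range has zero coordinates. A separating sequence of functionals, each
eventually zero along the sequence, then forces the point to be 0.

Separating sequences come from separability, so the work takes place in the closed span of the given
subspace and countably many vectors independent modulo `U`. Adjoining the given subspace to each
range lets it be added back at the end. -/

open Set Filter Topology

/-! ### Dual spans and surjectivity -/

section DualSpan

variable {𝕜 E V : Type*} [RCLike 𝕜] [NormedAddCommGroup E] [NormedSpace 𝕜 E]
  [NormedAddCommGroup V] [NormedSpace 𝕜 V]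

/-- If the transpose of `T` is bounded below, then each vector is approximated, up to half its
norm, by the image of a vector of controlled norm. -/
theorem exists_approx_preimage_of_dual_bound (T : E →L[𝕜] V) {C : ℝ} (hC : 0 < C)
    (h : ∀ f : StrongDual 𝕜 V, ‖f‖ ≤ C * ‖f.comp T‖) (v : V) :
    ∃ x, ‖v - T x‖ ≤ 1 / 2 * ‖v‖ ∧ ‖x‖ ≤ C * ‖v‖ := by
  let : NormedSpace ℝ V := NormedSpace.restrictScalars ℝ 𝕜 V
  let : NormedSpace ℝ E := NormedSpace.restrictScalars ℝ 𝕜 E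
  have : IsScalarTower ℝ 𝕜 V := IsScalarTower.restrictScalars ℝ 𝕜 V
  have : IsScalarTower ℝ 𝕜 E := IsScalarTower.restrictScalars ℝ 𝕜 E
  rcases eq_or_ne v 0 with rfl | hv
  · exact ⟨0, by simp⟩
  have hv0 : 0 < ‖v‖ := norm_pos_iff.2 hv
  have hR : 0 < C * ‖v‖ := mul_pos hC hv0
  -- Otherwise a separating `f` gives `C * ‖v‖ * ‖f.comp T‖ ≤ s < re (f v) ≤ ‖f‖ * ‖v‖`, against
  -- `h`.
  have hmem : v ∈ closure (T '' Metric.closedBall 0 (C * ‖v‖)) := by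
    by_contra hnot
    have hconv : Convex ℝ (closure (T '' Metric.closedBall 0 (C * ‖v‖))) :=
      ((convex_closedBall (0 : E) _).is_linear_image
        ((T.toLinearMap.restrictScalars ℝ).isLinear)).closure
    obtain ⟨f, s, hs, hsv⟩ :=
      RCLike.geometric_hahn_banach_closed_point (𝕜 := 𝕜) hconv isClosed_closure hnot
    have hball : ∀ z ∈ Metric.closedBall (0 : E) (C * ‖v‖), ‖f.comp T z‖ ≤ s := by
      intro z hz
      -- Separation controls only real parts; a unimodular factor turns this into a bound on the
      -- norm.
      obtain ⟨c, hc, hcz⟩ := RCLike.exists_norm_eq_mul_self (f.comp T z)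
      have hz' : c • z ∈ Metric.closedBall (0 : E) (C * ‖v‖) := by
        simpa [norm_smul, hc] using hz
      have := hs _ (subset_closure (mem_image_of_mem T hz'))
      have h2 : f (T (c • z)) = ((‖f.comp T z‖ : ℝ) : 𝕜) := by
        rw [hcz]; simp
      rw [h2, RCLike.ofReal_re] at this
      exact this.le
    have hn : ‖f.comp T‖ ≤ s / (C * ‖v‖) :=
      LinearMap.bound_of_ball_bound' hR s (f.comp T).toLinearMap hball |> fun hb =>
        ContinuousLinearMap.opNorm_le_bound _ (by
          have := hball 0 (by simp [hR.le])
          simp at this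
          positivity) hb
    have h3 : ‖f‖ * ‖v‖ ≤ s := by
      calc ‖f‖ * ‖v‖ ≤ (C * ‖f.comp T‖) * ‖v‖ := by gcongr; exact h f
        _ = ‖f.comp T‖ * (C * ‖v‖) := by ring
        _ ≤ s := (le_div_iff₀ hR).1 hn
    have h4 : RCLike.re (f v) ≤ ‖f‖ * ‖v‖ := (RCLike.re_le_norm _).trans (f.le_opNorm v)
    linarith
  obtain ⟨_, ⟨x, hx, rfl⟩, hd⟩ := Metric.mem_closure_iff.1 hmem (1 / 2 * ‖v‖) (by positivity)
  exact ⟨x, by rw [← dist_eq_norm]; exact hd.le, by simpa using hx⟩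

/-- The iterative step of the open mapping theorem: a continuous linear map on a Banach space with
controlled approximate preimages is surjective. -/
theorem surjective_of_exists_approx_preimage [CompleteSpace E] (T : E →L[𝕜] V) {C : ℝ}
    (h : ∀ v, ∃ x, ‖v - T x‖ ≤ 1 / 2 * ‖v‖ ∧ ‖x‖ ≤ C * ‖v‖) : Function.Surjective T := by
  choose g hg1 hg2 using h
  intro v
  let r : ℕ → V := fun n => (fun w => w - T (g w))^[n] v
  have hrs : ∀ n, r (n + 1) = r n - T (g (r n)) := fun n => Function.iterate_succ_apply' _ _ _
  have hr : ∀ n, ‖r n‖ ≤ (1 / 2) ^ n * ‖v‖ := by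
    intro n
    induction n with
    | zero => simp [r]
    | succ n ih =>
      rw [hrs]
      calc _ ≤ 1 / 2 * ‖r n‖ := hg1 _
        _ ≤ 1 / 2 * ((1 / 2) ^ n * ‖v‖) := by gcongr
        _ = _ := by ring
  have hsum : Summable fun n => g (r n) := by
    refine Summable.of_norm_bounded (g := fun n => |C| * ((1 / 2) ^ n * ‖v‖)) ?_ fun n => ?_
    · exact ((summable_geometric_of_lt_one (by norm_num) (by norm_num)).mul_right _).mul_left _
    · calc _ ≤ C * ‖r n‖ := hg2 _
        _ ≤ |C| * ‖r n‖ := by gcongr; exact le_abs_self C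
        _ ≤ _ := by gcongr; exact hr n
  have hpart : ∀ n, T (∑ i ∈ Finset.range n, g (r i)) = v - r n := by
    intro n
    induction n with
    | zero => simp [r]
    | succ n ih => rw [Finset.sum_range_succ, map_add, ih, hrs]; abel
  have hr0 : Tendsto r atTop (𝓝 0) := by
    refine squeeze_zero_norm hr ?_
    simpa using (tendsto_pow_atTop_nhds_zero_of_lt_one (r := (1 / 2 : ℝ)) (by norm_num)
      (by norm_num)).mul_const ‖v‖
  have h1 := (T.continuous.tendsto _).comp hsum.hasSum.tendsto_sum_nat
  have h2 : Tendsto (fun n => v - r n) atTop (𝓝 (v - 0)) := tendsto_const_nhds.sub hr0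
  refine ⟨∑' n, g (r n), ?_⟩
  have := tendsto_nhds_unique (h1.congr hpart) h2
  simpa using this

/-- The vectors on which the functionals `f` vanishing on `G` are at most `c * ‖f ∘ T‖`. -/
def polarHull (T : E →L[𝕜] V) (G : Submodule 𝕜 V) (c : ℝ) : Set V :=
  {x | ∀ f : StrongDual 𝕜 V, (∀ g ∈ G, f g = 0) → ‖f x‖ ≤ c * ‖f.comp T‖}

theorem isClosed_polarHull (T : E →L[𝕜] V) (G : Submodule 𝕜 V) (c : ℝ) :
    IsClosed (polarHull T G c) := by
  simp only [polarHull, ofPred_forall]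
  exact isClosed_iInter fun f => isClosed_iInter fun _ =>
    isClosed_le (by fun_prop) continuous_const

theorem polarHull_mono_right (T : E →L[𝕜] V) (G : Submodule 𝕜 V) {c d : ℝ} (h : c ≤ d) :
    polarHull T G c ⊆ polarHull T G d := fun _ hx f hf =>
  (hx f hf).trans (by gcongr)

/-- The linear span of the polar hulls: the vectors not separated from `G` by functionals whose
composition with `T` is small. -/
def dualSpan (T : E →L[𝕜] V) (G : Submodule 𝕜 V) : Submodule 𝕜 V where
  carrier := {x | ∃ c, x ∈ polarHull T G c}
  zero_mem' := ⟨0, fun f _ => by simp⟩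
  add_mem' := by
    rintro x y ⟨c, hx⟩ ⟨d, hy⟩
    refine ⟨c + d, fun f hf => ?_⟩
    rw [map_add, add_mul]
    exact (norm_add_le _ _).trans (add_le_add (hx f hf) (hy f hf))
  smul_mem' := by
    rintro a x ⟨c, hx⟩
    refine ⟨‖a‖ * c, fun f hf => ?_⟩
    rw [map_smul, norm_smul, mul_assoc]
    exact mul_le_mul_of_nonneg_left (hx f hf) (norm_nonneg a)

theorem mem_dualSpan {T : E →L[𝕜] V} {G : Submodule 𝕜 V} {x : V} :
    x ∈ dualSpan T G ↔ ∃ c, x ∈ polarHull T G c := Iff.rfl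

theorem coe_dualSpan (T : E →L[𝕜] V) (G : Submodule 𝕜 V) :
    (dualSpan T G : Set V) = ⋃ n : ℕ, polarHull T G n := by
  ext x
  simp only [SetLike.mem_coe, mem_dualSpan, mem_iUnion]
  constructor
  · rintro ⟨c, hc⟩
    obtain ⟨n, hn⟩ := exists_nat_ge c
    exact ⟨n, polarHull_mono_right T G hn hc⟩
  · rintro ⟨n, hn⟩
    exact ⟨n, hn⟩

theorem dualSpan_mono (T : E →L[𝕜] V) {G H : Submodule 𝕜 V} (h : G ≤ H) :
    dualSpan T G ≤ dualSpan T H := fun _ ⟨c, hc⟩ =>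
  ⟨c, fun f hf => hc f fun g hg => hf g (h hg)⟩

theorem le_dualSpan (T : E →L[𝕜] V) (G : Submodule 𝕜 V) : G ≤ dualSpan T G := fun x hx =>
  ⟨0, fun f hf => by simp [hf x hx]⟩

/-- Outside the dual span, `x` is separated from `G` by functionals that are small on `T`. -/
theorem exists_dual_of_notMem_dualSpan {T : E →L[𝕜] V} {G : Submodule 𝕜 V} {x : V}
    (hx : x ∉ dualSpan T G) {ε : ℝ} (hε : 0 < ε) :
    ∃ f : StrongDual 𝕜 V, (∀ g ∈ G, f g = 0) ∧ f x = 1 ∧ ‖f.comp T‖ ≤ ε := by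
  have h : x ∉ polarHull T G ε⁻¹ := fun h => hx ⟨_, h⟩
  simp only [polarHull, mem_ofPred_eq, not_forall, not_le] at h
  obtain ⟨f, hf, hlt⟩ := h
  have hpos : 0 < ‖f x‖ := lt_of_le_of_lt (by positivity) hlt
  have hne : f x ≠ 0 := norm_pos_iff.1 hpos
  refine ⟨(f x)⁻¹ • f, fun g hg => by simp [hf g hg], by simp [hne], ?_⟩
  rw [ContinuousLinearMap.smul_comp, norm_smul, norm_inv, inv_mul_le_iff₀ hpos]
  rw [inv_mul_lt_iff₀ hε] at hlt
  linarith

/-- The exchange property of the dual span. -/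
theorem mem_dualSpan_exchange {T : E →L[𝕜] V} {G : Submodule 𝕜 V} {x v : V}
    (hx : x ∉ dualSpan T G) (hxv : x ∈ dualSpan T (G ⊔ 𝕜 ∙ v)) :
    v ∈ dualSpan T (G ⊔ 𝕜 ∙ x) := by
  have key : ∀ (f : StrongDual 𝕜 V) (w : V), (∀ g ∈ G, f g = 0) → f w = 0 →
      ∀ g ∈ G ⊔ 𝕜 ∙ w, f g = 0 := by
    intro f w hf hw g hg
    obtain ⟨a, ha, b, hb, rfl⟩ := Submodule.mem_sup.1 hg
    obtain ⟨t, rfl⟩ := Submodule.mem_span_singleton.1 hb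
    simp [hf a ha, hw]
  obtain ⟨c, hc⟩ := hxv
  have hc' : x ∈ polarHull T (G ⊔ 𝕜 ∙ v) (max c 1) := polarHull_mono_right _ _ (le_max_left _ _) hc
  set d := max c 1
  have hd : 0 < d := lt_of_lt_of_le one_pos (le_max_right _ _)
  -- With this `ε`, the error from correcting by `h` is at most half the quantity estimated in `h4`,
  -- so it is absorbed.
  obtain ⟨h, hG, hhx, hhT⟩ := exists_dual_of_notMem_dualSpan hx (ε := d⁻¹ / 2) (by positivity)
  have hdT : d * ‖h.comp T‖ ≤ 1 / 2 := by
    calc d * ‖h.comp T‖ ≤ d * (d⁻¹ / 2) := by gcongr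
      _ = 1 / 2 := by field_simp
  have hhv : h v ≠ 0 := by
    intro h0
    have := hc' h (key h v hG h0)
    rw [hhx, norm_one] at this
    linarith
  refine ⟨2 * d * ‖h v‖, fun f hf => ?_⟩
  have hfG : ∀ g ∈ G, f g = 0 := fun g hg => hf g (le_sup_left (a := G) hg)
  have hfx : f x = 0 := hf x (le_sup_right (a := G) (Submodule.mem_span_singleton_self x))
  -- The correction kills `v`, which makes the bound for `x` applicable; the value at `x` then
  -- recovers `f v / h v`.
  have h1 := hc' (f - (f v / h v) • h) (key _ v (fun g hg => by simp [hfG g hg, hG g hg])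
    (by simp [hhv]))
  have h2 : ‖(f - (f v / h v) • h) x‖ = ‖f v‖ / ‖h v‖ := by simp [hfx, hhx]
  have h3 : ‖(f - (f v / h v) • h).comp T‖ ≤ ‖f.comp T‖ + ‖f v‖ / ‖h v‖ * ‖h.comp T‖ := by
    rw [ContinuousLinearMap.sub_comp, ContinuousLinearMap.smul_comp]
    refine (norm_sub_le _ _).trans ?_
    rw [norm_smul, norm_div]
  have hpos : 0 < ‖h v‖ := norm_pos_iff.2 hhv
  have h4 : ‖f v‖ / ‖h v‖ ≤ d * ‖f.comp T‖ + ‖f v‖ / ‖h v‖ * (1 / 2) := by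
    calc ‖f v‖ / ‖h v‖ ≤ d * (‖f.comp T‖ + ‖f v‖ / ‖h v‖ * ‖h.comp T‖) := by
          rw [← h2]; exact h1.trans (by rw [h2]; gcongr)
      _ = d * ‖f.comp T‖ + ‖f v‖ / ‖h v‖ * (d * ‖h.comp T‖) := by ring
      _ ≤ _ := by gcongr
  have h5 : ‖f v‖ / ‖h v‖ ≤ 2 * d * ‖f.comp T‖ := by linarith
  rw [div_le_iff₀ hpos] at h5
  linarith

variable [CompleteSpace E] [CompleteSpace V]

/-- A continuous linear map between Banach spaces is surjective if its transpose dominates every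
evaluation. -/
theorem surjective_of_dualSpan_bot_eq_top (T : E →L[𝕜] V) (h : dualSpan T ⊥ = ⊤) :
    Function.Surjective T := by
  have hU : ⋃ n : ℕ, polarHull T ⊥ (n : ℝ) = univ := by rw [← coe_dualSpan, h]; rfl
  obtain ⟨n, a, ha⟩ := nonempty_interior_of_iUnion_of_closed
    (fun n : ℕ => isClosed_polarHull T ⊥ n) hU
  obtain ⟨ε, hε, hsub⟩ := Metric.mem_nhds_iff.1 (mem_interior_iff_mem_nhds.1 ha)
  -- Differences of two points of the polar hull cost `2 * n`; the extra 1 keeps the constant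
  -- positive when `n = 0`.
  have hbound : ∀ f : StrongDual 𝕜 V, ‖f‖ ≤ ((2 * n + 1) / (ε / 2)) * ‖f.comp T‖ := by
    intro f
    have hf : ∀ g ∈ (⊥ : Submodule 𝕜 V), f g = 0 := by simp
    have hb : ∀ z ∈ Metric.closedBall (0 : V) (ε / 2), ‖f z‖ ≤ (2 * n + 1) * ‖f.comp T‖ := by
      intro z hz
      have h1 : a + z ∈ Metric.ball a ε := by
        simp at hz ⊢; linarith
      have h2 := hsub h1 f hf
      have h3 := hsub (Metric.mem_ball_self hε) f hf
      have h4 : f z = f (a + z) - f a := by simp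
      rw [h4]
      have := norm_sub_le (f (a + z)) (f a)
      nlinarith [norm_nonneg (f.comp T)]
    refine ContinuousLinearMap.opNorm_le_bound _ (by positivity) fun z => ?_
    have := LinearMap.bound_of_ball_bound' (half_pos hε) _ f.toLinearMap hb z
    calc _ ≤ _ := this
      _ = _ := by ring
  exact surjective_of_exists_approx_preimage T
    (exists_approx_preimage_of_dual_bound T (by positivity) hbound)

/-- Functionals on `V ⧸ G` pull back to functionals vanishing on `G`, so the surjectivity criterion
applies to `T` followed by the quotient map. -/
theorem range_sup_eq_top_of_dualSpan_eq_top (T : E →L[𝕜] V) (G : Submodule 𝕜 V)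
    [FiniteDimensional 𝕜 G] (h : dualSpan T G = ⊤) : T.range ⊔ G = ⊤ := by
  have : IsClosed (G : Set V) := G.closed_of_finiteDimensional
  have hs : Function.Surjective (G.mkQL.comp T) := by
    refine surjective_of_dualSpan_bot_eq_top _ (eq_top_iff.2 fun y _ => ?_)
    obtain ⟨x, rfl⟩ := G.mkQ_surjective y
    obtain ⟨c, hc⟩ : x ∈ dualSpan T G := h ▸ Submodule.mem_top
    refine ⟨c, fun f _ => hc (f.comp G.mkQL) fun g hg => ?_⟩
    have : G.mkQL g = 0 := (Submodule.Quotient.mk_eq_zero G).2 hg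
    simp [this]
  refine eq_top_iff.2 fun v _ => ?_
  obtain ⟨e, he⟩ := hs (G.mkQ v)
  have : v - T e ∈ G := by
    rw [← Submodule.Quotient.mk_eq_zero, Submodule.Quotient.mk_sub, sub_eq_zero]
    exact he.symm
  have h2 := Submodule.add_mem_sup (LinearMap.mem_range_self T.toLinearMap e) this
  simpa using h2

end DualSpan

/-! ### Biorthogonal sequences by a Baire category construction -/

section Biorthogonal

variable {𝕜 V : Type*} [RCLike 𝕜] [NormedAddCommGroup V] [NormedSpace 𝕜 V]
  {E : ℕ → Type*} [∀ r, NormedAddCommGroup (E r)] [∀ r, NormedSpace 𝕜 (E r)]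

/-- Each member of `G` lies outside the dual span of the other ones. -/
def DualIndependent (T : ∀ r, E r →L[𝕜] V) (G : Finset V) : Prop :=
  ∀ r, ∀ x ∈ G, x ∉ dualSpan (T r) (Submodule.span 𝕜 ((G : Set V) \ {x}))

theorem DualIndependent.insert [DecidableEq V] {T : ∀ r, E r →L[𝕜] V} {G : Finset V}
    (hG : DualIndependent T G) {y : V}
    (hy : ∀ r, y ∉ dualSpan (T r) (Submodule.span 𝕜 (G : Set V))) :
    DualIndependent T (insert y G) := by
  have hyG : y ∉ G := fun h => hy 0 (le_dualSpan _ _ (Submodule.subset_span h))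
  intro r x hx hmem
  rcases Finset.mem_insert.1 hx with rfl | hxG
  · refine hy r (dualSpan_mono _ (Submodule.span_mono ?_) hmem)
    intro z hz
    exact (Finset.mem_insert.1 hz.1).resolve_left hz.2
  · have hset : ((Insert.insert y G : Finset V) : Set V) \ {x} ⊆ ((G : Set V) \ {x}) ∪ {y} := by
      rintro z ⟨hz, hzx⟩
      rcases Finset.mem_insert.1 (Finset.mem_coe.1 hz) with rfl | h
      · exact Or.inr rfl
      · exact Or.inl ⟨h, hzx⟩
    have h1 := dualSpan_mono (T r) (Submodule.span_mono (R := 𝕜) hset) hmem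
    rw [Submodule.span_union] at h1
    have h2 := mem_dualSpan_exchange (hG r x hxG) h1
    refine hy r (dualSpan_mono _ ?_ h2)
    rw [← Submodule.span_union]
    exact Submodule.span_mono (union_subset sdiff_subset (singleton_subset_iff.2 hxG))

variable [CompleteSpace V] [∀ r, CompleteSpace (E r)]

/-- Finitely many functionals have a common zero outside countably many dual spans, when the
operators have ranges of infinite codimension. -/
theorem exists_notMem_dualSpan_of_forall_apply_eq_zero (T : ∀ r, E r →L[𝕜] V)
    (hT : ∀ r (G : Submodule 𝕜 V), FiniteDimensional 𝕜 G → (T r).range ⊔ G ≠ ⊤)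
    (Ψ : Finset (StrongDual 𝕜 V)) (G : Submodule 𝕜 V) [FiniteDimensional 𝕜 G] :
    ∃ y, (∀ f ∈ Ψ, f y = 0) ∧ ∀ r, y ∉ dualSpan (T r) G := by
  let P : V →L[𝕜] (Ψ → 𝕜) := ContinuousLinearMap.pi fun f => f.1
  let Z : Submodule 𝕜 V := P.ker
  have hZ : IsClosed (Z : Set V) := P.isClosed_ker
  have : CompleteSpace Z := hZ.completeSpace_coe
  obtain ⟨H, hH⟩ := Submodule.exists_isCompl Z
  have hHfd : FiniteDimensional 𝕜 H :=
    Module.Finite.equiv (P.toLinearMap.quotKerEquivRange.symm.trans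
      (Submodule.quotientEquivOfIsCompl Z H hH))
  -- If the dual span contained `Z`, enlarging `G` by the finite-dimensional complement `H` would
  -- make it everything.
  have hproper : ∀ r, (dualSpan (T r) G).comap Z.subtype ≠ ⊤ := by
    intro r htop
    refine hT r (G ⊔ H) inferInstance (range_sup_eq_top_of_dualSpan_eq_top _ _ ?_)
    rw [eq_top_iff, ← hH.sup_eq_top, sup_le_iff]
    refine ⟨?_, le_sup_right.trans (le_dualSpan _ _)⟩
    exact (Submodule.comap_subtype_eq_top.1 htop).trans (dualSpan_mono _ le_sup_left)
  by_contra! hcon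
  have hcover : ⋃ i : ℕ × ℕ, (Z.subtype ⁻¹' polarHull (T i.1) G (i.2 : ℝ)) = univ := by
    refine eq_univ_of_forall fun z => ?_
    obtain ⟨r, hr⟩ := hcon z fun f hf => congrFun (LinearMap.mem_ker.1 z.2) ⟨f, hf⟩
    rw [← SetLike.mem_coe, coe_dualSpan, mem_iUnion] at hr
    obtain ⟨n, hn⟩ := hr
    exact mem_iUnion.2 ⟨(r, n), hn⟩
  obtain ⟨⟨r, n⟩, hne⟩ := nonempty_interior_of_iUnion_of_closed
    (fun i : ℕ × ℕ => (isClosed_polarHull (T i.1) G (i.2 : ℝ)).preimage continuous_subtype_val)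
    hcover
  refine hproper r (Submodule.eq_top_of_nonempty_interior' _ (hne.mono (interior_mono ?_)))
  intro z hz
  exact ⟨_, hz⟩

/-- `Ψ'` records the functionals found so far: choosing later vectors in their kernels keeps those
functionals biorthogonal. -/
theorem exists_insert_dualIndependent [DecidableEq V] (T : ∀ r, E r →L[𝕜] V)
    (hT : ∀ r (G : Submodule 𝕜 V), FiniteDimensional 𝕜 G → (T r).range ⊔ G ≠ ⊤)
    (φ : StrongDual 𝕜 V) (n : ℕ) (G : Finset V) (hG : DualIndependent T G)
    (Ψ : Finset (StrongDual 𝕜 V)) :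
    ∃ (y : V) (Ψ' : Finset (StrongDual 𝕜 V)), y ∉ G ∧ DualIndependent T (insert y G) ∧
      (∀ f ∈ Ψ, f y = 0) ∧ Ψ ⊆ Ψ' ∧ φ ∈ Ψ' ∧
      ∀ r ≤ n, ∀ x ∈ insert y G, ∃ f ∈ Ψ', f x = 1 ∧ (∀ g ∈ insert y G, g ≠ x → f g = 0) ∧
        ‖f.comp (T r)‖ ≤ 1 / ((n : ℝ) + 1) := by
  classical
  obtain ⟨y, hy0, hy⟩ := exists_notMem_dualSpan_of_forall_apply_eq_zero T hT Ψ
    (Submodule.span 𝕜 (G : Set V))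
  have hyG : y ∉ G := fun h => hy 0 (le_dualSpan _ _ (Submodule.subset_span h))
  have hI := hG.insert hy
  have hf : ∀ r x, ∃ f : StrongDual 𝕜 V, x ∈ insert y G → f x = 1 ∧
      (∀ g ∈ insert y G, g ≠ x → f g = 0) ∧ ‖f.comp (T r)‖ ≤ 1 / ((n : ℝ) + 1) := by
    intro r x
    by_cases hx : x ∈ insert y G
    · obtain ⟨f, h1, h2, h3⟩ := exists_dual_of_notMem_dualSpan (hI r x hx)
        (ε := 1 / ((n : ℝ) + 1)) (by positivity)
      exact ⟨f, fun _ => ⟨h2, fun g hg hgx => h1 g (Submodule.subset_span ⟨hg, hgx⟩), h3⟩⟩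
    · exact ⟨0, fun h => absurd h hx⟩
  choose F hF using hf
  refine ⟨y, insert φ (Ψ ∪ (Finset.range (n + 1) ×ˢ insert y G).image fun p => F p.1 p.2),
    hyG, hI, hy0, ?_, Finset.mem_insert_self _ _, fun r hr x hx => ⟨F r x, ?_, hF r x hx⟩⟩
  · exact Finset.subset_union_left.trans (Finset.subset_insert _ _)
  · refine Finset.mem_insert_of_mem (Finset.mem_union_right _ (Finset.mem_image.2 ⟨(r, x), ?_, rfl⟩))
    exact Finset.mem_product.2 ⟨Finset.mem_range.2 (Nat.lt_succ_of_le hr), hx⟩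

/-- There is a sequence with biorthogonal functionals that are arbitrarily small on any of the
given operators of infinite codimensional range, and on which any of countably many prescribed
functionals eventually vanishes. -/
theorem exists_seq_biorthogonal (T : ∀ r, E r →L[𝕜] V)
    (hT : ∀ r (G : Submodule 𝕜 V), FiniteDimensional 𝕜 G → (T r).range ⊔ G ≠ ⊤)
    (φ : ℕ → StrongDual 𝕜 V) :
    ∃ x : ℕ → V, (∀ n r, ∀ ε > 0, ∃ f : StrongDual 𝕜 V,
        f (x n) = 1 ∧ (∀ k, k ≠ n → f (x k) = 0) ∧ ‖f.comp (T r)‖ ≤ ε) ∧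
      ∀ i, ∃ N, ∀ k ≥ N, φ i (x k) = 0 := by
  classical
  choose y Ψ' hyG hI hy0 hΨ hφ hf using fun n => exists_insert_dualIndependent T hT (φ n) n
  let step : ℕ → {s : Finset V × Finset (StrongDual 𝕜 V) // DualIndependent T s.1} →
      {s : Finset V × Finset (StrongDual 𝕜 V) // DualIndependent T s.1} :=
    fun n s => ⟨(insert (y n s.1.1 s.2 s.1.2) s.1.1, Ψ' n s.1.1 s.2 s.1.2), hI n s.1.1 s.2 s.1.2⟩
  let s : ℕ → {s : Finset V × Finset (StrongDual 𝕜 V) // DualIndependent T s.1} :=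
    fun n => Nat.rec ⟨(∅, ∅), fun r x hx => absurd hx (Finset.notMem_empty x)⟩ step n
  let x : ℕ → V := fun n => y n (s n).1.1 (s n).2 (s n).1.2
  have hGmono : Monotone fun n => (s n).1.1 :=
    monotone_nat_of_le_succ fun n => Finset.subset_insert _ _
  have hΨmono : Monotone fun n => (s n).1.2 :=
    monotone_nat_of_le_succ fun n => hΨ n (s n).1.1 (s n).2 (s n).1.2
  have hxmem : ∀ {k n}, k < n → x k ∈ (s n).1.1 := fun {k n} h =>
    hGmono (Nat.succ_le_of_lt h) (Finset.mem_insert_self _ _)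
  have hxne : ∀ {k n}, k < n → x k ≠ x n := fun {k n} h he =>
    hyG n (s n).1.1 (s n).2 (s n).1.2 (by have := hxmem h; rwa [he] at this)
  have hzero : ∀ {n k} {f : StrongDual 𝕜 V}, f ∈ (s n).1.2 → n ≤ k → f (x k) = 0 :=
    fun {n k f} hfn h => hy0 k (s k).1.1 (s k).2 (s k).1.2 f (hΨmono h hfn)
  refine ⟨x, fun n r ε hε => ?_, fun i => ⟨i + 1, fun k hk => ?_⟩⟩
  · obtain ⟨m, hm⟩ := exists_nat_one_div_lt hε
    -- Stage `j` treats both `x n` and `T r` with tolerance at most `ε`. Its functional handles `k ≤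
    -- j` by construction; later vectors lie in its kernel.
    let j := max (max n r) m
    have hnj : n ≤ j := (le_max_left _ _).trans (le_max_left _ _)
    have hrj : r ≤ j := (le_max_right _ _).trans (le_max_left _ _)
    have hmj : m ≤ j := le_max_right _ _
    obtain ⟨f, hfm, h1, h2, h3⟩ := hf j (s j).1.1 (s j).2 (s j).1.2 r hrj (x n)
      (hxmem (Nat.lt_succ_of_le hnj))
    refine ⟨f, h1, fun k hk => ?_, h3.trans ((one_div_le_one_div_of_le (by positivity) ?_).trans
      hm.le)⟩
    · rcases Nat.lt_or_ge k (j + 1) with hkj | hkj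
      · refine h2 _ (hxmem hkj) ?_
        rcases lt_or_gt_of_ne hk with h | h
        · exact hxne h
        · exact (hxne h).symm
      · exact hzero (n := j + 1) hfm hkj
    · exact_mod_cast Nat.succ_le_succ hmj
  · exact hzero (n := i + 1) (hφ i (s i).1.1 (s i).2 (s i).1.2) hk

end Biorthogonal

/-! ### The closed span: its dimension and its avoidance of the ranges -/

section ClosedSubspace

variable {𝕜 V : Type*} [RCLike 𝕜] [NormedAddCommGroup V] [NormedSpace 𝕜 V] [CompleteSpace V]

/-- A closed subspace of a Banach space containing an infinite biorthogonal system has dimension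
at least the continuum. -/
theorem continuum_le_rank_of_biorthogonal (F : Submodule 𝕜 V) (hF : IsClosed (F : Set V))
    (x : ℕ → V) (hx : ∀ n, x n ∈ F) (f : ℕ → StrongDual 𝕜 V)
    (hf : ∀ n, f n (x n) = 1) (hf0 : ∀ n k, k ≠ n → f n (x k) = 0) :
    Cardinal.continuum ≤ Module.rank 𝕜 F := by
  let c : ℕ → ℝ := fun n => (1 + ‖x n‖)⁻¹
  have hc : ∀ n, 0 < c n := fun n => by positivity
  have hcx : ∀ n, c n * ‖x n‖ ≤ 1 := fun n => by
    rw [inv_mul_le_iff₀ (by positivity)]; linarith [norm_nonneg (x n)]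
  let u : Ioo (0 : ℝ) 1 → ℕ → V := fun t n => ((c n : 𝕜) * (t.1 : 𝕜) ^ n) • x n
  have hu : ∀ t, Summable (u t) := by
    intro t
    refine Summable.of_norm_bounded (summable_geometric_of_lt_one t.2.1.le t.2.2) fun n => ?_
    have : ‖u t n‖ = c n * ‖x n‖ * t.1 ^ n := by
      simp only [u, norm_smul, norm_mul, norm_pow, RCLike.norm_ofReal, abs_of_pos (hc n),
        abs_of_pos t.2.1]
      ring
    rw [this]
    exact mul_le_of_le_one_left (pow_nonneg t.2.1.le n) (hcx n)
  let v : Ioo (0 : ℝ) 1 → F := fun t => ⟨∑' n, u t n,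
    hF.mem_of_tendsto (hu t).hasSum.tendsto_sum_nat
      (Eventually.of_forall fun N => F.sum_mem fun n _ => F.smul_mem _ (hx n))⟩
  have hv : ∀ t n, f n (v t) = (c n : 𝕜) * (t.1 : 𝕜) ^ n := by
    intro t n
    change f n (∑' k, u t k) = _
    rw [(f n).map_tsum (hu t), tsum_eq_single n fun k hk => by simp [u, hf0 n k hk]]
    simp [u, hf n]
  let Φ : F →ₗ[𝕜] (Multiplicative ℕ → 𝕜) :=
    LinearMap.pi fun n => (c n.toAdd : 𝕜)⁻¹ • (f n.toAdd).toLinearMap.comp F.subtype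
  have hinj : Function.Injective
      fun t : Ioo (0 : ℝ) 1 => powersHom 𝕜 (t.1 : 𝕜) := by
    intro s t hst
    exact Subtype.ext (RCLike.ofReal_injective ((powersHom 𝕜).injective hst))
  -- The rescaled coordinates of `v t` are the powers of `t`; distinct characters of a monoid are
  -- independent.
  have hli : LinearIndependent 𝕜 (Φ ∘ v) := by
    have := (linearIndependent_monoidHom (Multiplicative ℕ) 𝕜).comp _ hinj
    suffices heq : Φ ∘ v = (fun g : Multiplicative ℕ →* 𝕜 => (g : Multiplicative ℕ → 𝕜)) ∘
        fun t : Ioo (0 : ℝ) 1 => powersHom 𝕜 (t.1 : 𝕜) by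
      rw [heq]; exact this
    ext t n
    have hcn : (c n.toAdd : 𝕜) ≠ 0 := RCLike.ofReal_ne_zero.2 (hc _).ne'
    simp [Φ, hv, hcn]
  have := (LinearIndependent.of_comp Φ hli).cardinal_lift_le_rank
  rw [Cardinal.mk_Ioo_real one_pos] at this
  simpa using this

/-- In a separable normed space countably many functionals separate points. -/
theorem exists_seq_dual_separating (𝕜 V : Type*) [RCLike 𝕜] [NormedAddCommGroup V]
    [NormedSpace 𝕜 V] [TopologicalSpace.SeparableSpace V] :
    ∃ φ : ℕ → StrongDual 𝕜 V, ∀ z, (∀ i, φ i z = 0) → z = 0 := by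
  choose φ hφ1 hφ2 using fun i => exists_dual_vector'' 𝕜 (TopologicalSpace.denseSeq V i)
  refine ⟨φ, fun z hz => norm_le_zero_iff.1 (le_of_forall_pos_le_add fun ε hε => ?_)⟩
  obtain ⟨_, ⟨i, rfl⟩, hi⟩ := Metric.mem_closure_iff.1
    (TopologicalSpace.denseRange_denseSeq V z) (ε / 2) (by positivity)
  set d := TopologicalSpace.denseSeq V i
  rw [dist_eq_norm] at hi
  have h1 : ‖d‖ ≤ ‖z - d‖ := by
    have : φ i (z - d) = -(‖d‖ : 𝕜) := by rw [map_sub, hz i, hφ2 i, zero_sub]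
    calc ‖d‖ = ‖φ i (z - d)‖ := by rw [this]; simp
      _ ≤ 1 * ‖z - d‖ := (φ i).le_of_opNorm_le (hφ1 i) _
      _ = _ := one_mul _
  have h2 : ‖z‖ ≤ ‖z - d‖ + ‖d‖ := by simpa using norm_add_le (z - d) d
  linarith

/-- In a separable Banach space, countably many operators with ranges of infinite codimension
miss a common closed subspace of dimension at least the continuum. -/
theorem exists_isClosed_disjoint_range [TopologicalSpace.SeparableSpace V]
    {E : ℕ → Type*} [∀ r, NormedAddCommGroup (E r)] [∀ r, NormedSpace 𝕜 (E r)]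
    [∀ r, CompleteSpace (E r)] (T : ∀ r, E r →L[𝕜] V)
    (hT : ∀ r (G : Submodule 𝕜 V), FiniteDimensional 𝕜 G → (T r).range ⊔ G ≠ ⊤) :
    ∃ F : Submodule 𝕜 V, IsClosed (F : Set V) ∧ Cardinal.continuum ≤ Module.rank 𝕜 F ∧
      ∀ r, Disjoint F (T r).range := by
  obtain ⟨φ, hφ⟩ := exists_seq_dual_separating 𝕜 V
  obtain ⟨x, hx, hφx⟩ := exists_seq_biorthogonal T hT φ
  -- The values 0 and 1 are arbitrary: any two coordinate functionals at `n` agree on `F`.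
  choose f hf1 hf0 _ using fun n => hx n 0 1 one_pos
  let F := (Submodule.span 𝕜 (range x)).topologicalClosure
  have hxF : ∀ n, x n ∈ F := fun n =>
    Submodule.le_topologicalClosure _ (Submodule.subset_span (mem_range_self n))
  have hzero : ∀ h : StrongDual 𝕜 V, (∀ n, h (x n) = 0) → ∀ z ∈ F, h z = 0 := by
    intro h hh z hz
    have hle : F ≤ h.ker := by
      refine Submodule.topologicalClosure_minimal _ (Submodule.span_le.2 ?_) h.isClosed_ker
      rintro _ ⟨n, rfl⟩
      exact hh n
    exact hle hz
  have hFc : IsClosed (F : Set V) := Submodule.isClosed_topologicalClosure _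
  refine ⟨F, hFc, continuum_le_rank_of_biorthogonal F hFc x hxF f hf1 hf0, fun r => ?_⟩
  rw [Submodule.disjoint_def]
  rintro _ hz ⟨y, rfl⟩
  have hfz : ∀ n, f n (T r y) = 0 := by
    intro n
    refine norm_le_zero_iff.1 (le_of_forall_pos_le_add fun ε hε => ?_)
    obtain ⟨g, hg1, hg0, hgT⟩ := hx n r (ε / (‖y‖ + 1)) (by positivity)
    have heq : f n (T r y) = g (T r y) := by
      have := hzero (f n - g) (fun k => ?_) _ hz
      · exact sub_eq_zero.1 this
      · rcases eq_or_ne k n with rfl | hk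
        · simp [hf1, hg1]
        · simp [hf0 n k hk, hg0 k hk]
    rw [heq, zero_add]
    calc ‖g (T r y)‖ ≤ ε / (‖y‖ + 1) * ‖y‖ := (g.comp (T r)).le_of_opNorm_le hgT y
      _ ≤ ε / (‖y‖ + 1) * (‖y‖ + 1) := by gcongr; linarith
      _ = ε := by field_simp
  refine hφ _ fun i => ?_
  obtain ⟨N, hN⟩ := hφx i
  -- On `F`, `φ i` is a finite combination of coordinates, all of which vanish at the point.
  have hh := hzero (φ i - ∑ n ∈ Finset.range N, φ i (x n) • f n) (fun k => ?_) _ hz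
  · simpa [hfz] using hh
  · simp only [sub_apply, sum_apply,
      smul_apply, smul_eq_mul]
    rcases Nat.lt_or_ge k N with hk | hk
    · rw [Finset.sum_eq_single_of_mem k (Finset.mem_range.2 hk)
        fun n _ hn => by rw [hf0 n k hn.symm, mul_zero], hf1, mul_one, sub_self]
    · rw [hN k hk, Finset.sum_eq_zero, sub_zero]
      intro n hn
      rw [hf0 n k, mul_zero]
      have := Finset.mem_range.1 hn
      omega

end ClosedSubspace

/-! ### Reduction to operators on a separable space -/

section Reduction

/-- A point is determined by its distances to a dense sequence. -/
theorem cardinalMk_le_continuum_of_separableSpace (X : Type*) [MetricSpace X]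
    [TopologicalSpace.SeparableSpace X] : Cardinal.mk X ≤ Cardinal.continuum := by
  cases isEmpty_or_nonempty X
  · simp
  let d := TopologicalSpace.denseSeq X
  have hinj : Function.Injective fun (x : X) (i : ℕ) => dist x (d i) := by
    intro x y hxy
    refine dist_le_zero.1 (le_of_forall_pos_le_add fun ε hε => ?_)
    obtain ⟨_, ⟨i, rfl⟩, hi⟩ := Metric.mem_closure_iff.1
      (TopologicalSpace.denseRange_denseSeq X x) (ε / 2) (by positivity)
    have h1 : dist x (d i) = dist y (d i) := congrFun hxy i
    have h2 := dist_triangle_right x y (d i)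
    change dist x (d i) < _ at hi
    linarith
  have := Cardinal.mk_le_of_injective (Function.Injective.comp
    (ULift.up_injective) hinj : Function.Injective fun x : X => (ULift.up _ : ULift (ℕ → ℝ)))
  simpa [Cardinal.mk_real] using this

universe u

variable {𝕜 V : Type*} [RCLike 𝕜] [NormedAddCommGroup V] [NormedSpace 𝕜 V]

/-- `W`, with a type tag that does not inherit the norm of the ambient space. -/
def Submodule.Renormed (W : Submodule 𝕜 V) : Type _ := W

/-- A subspace that is complete for a stronger norm is the range of a continuous linear map defined
on a Banach space. -/
theorem exists_range_eq_of_isBanachNorm {V : Type u} [NormedAddCommGroup V] [NormedSpace 𝕜 V]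
    (W : Submodule 𝕜 V) (p : Seminorm 𝕜 W) (C : ℝ)
    (hp : IsBanachNorm p) (hC : ∀ x : W, ‖(x : V)‖ ≤ C * p x) :
    ∃ (E : Type u) (_ : NormedAddCommGroup E) (_ : NormedSpace 𝕜 E) (_ : CompleteSpace E)
      (T : E →L[𝕜] V), T.range = W := by
  let _ : AddCommGroup W.Renormed := inferInstanceAs (AddCommGroup W)
  let _ : Module 𝕜 W.Renormed := inferInstanceAs (Module 𝕜 W)
  let q : Seminorm 𝕜 W.Renormed := p
  let _ : SeminormedAddCommGroup W.Renormed := q.toAddGroupSeminorm.toSeminormedAddCommGroup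
  let _ : NormedAddCommGroup W.Renormed := NormedAddCommGroup.ofSeparation hp.1
  let _ : NormedSpace 𝕜 W.Renormed := ⟨fun a x => (map_smul_eq_mul q a x).le⟩
  let T : W.Renormed →ₗ[𝕜] V := W.subtype
  refine ⟨W.Renormed, inferInstance, inferInstance, hp.2, T.mkContinuous C hC, ?_⟩
  exact W.range_subtype

/-- In a quotient of infinite dimension, an independent sequence lifts to the whole space. -/
theorem exists_seq_linearIndependent_mkQ {K M : Type*} [DivisionRing K] [AddCommGroup M]
    [Module K M] (U : Submodule K M) (h : ¬ FiniteDimensional K (M ⧸ U)) :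
    ∃ b : ℕ → M, LinearIndependent K (U.mkQ ∘ b) := by
  let B := Module.Basis.ofVectorSpace K (M ⧸ U)
  have : Infinite (Module.Basis.ofVectorSpaceIndex K (M ⧸ U)) := by
    by_contra hfin
    rw [not_infinite_iff_finite] at hfin
    exact h (Module.Finite.of_basis B)
  choose b hb using fun n => U.mkQ_surjective (B (Infinite.natEmbedding _ n))
  refine ⟨b, ?_⟩
  have heq : U.mkQ ∘ b = B ∘ Infinite.natEmbedding _ := funext hb
  rw [heq]
  exact B.linearIndependent.comp _ (Infinite.natEmbedding _).injective

theorem isLineable_compl_of_linearIndependent_mkQ (U : Submodule 𝕜 V) (b : ℕ → V)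
    (hb : LinearIndependent 𝕜 (U.mkQ ∘ b)) (n : ℕ) :
    IsLineable 𝕜 (n : Cardinal) (U : Set V)ᶜ := by
  have hn : LinearIndependent 𝕜 (U.mkQ ∘ (b ∘ ((↑) : Fin n → ℕ))) :=
    hb.comp _ Fin.val_injective
  refine ⟨Submodule.span 𝕜 (range (b ∘ ((↑) : Fin n → ℕ))), ?_, ?_⟩
  · have := rank_eq_card_basis (Module.Basis.span (LinearIndependent.of_comp _ hn))
    simpa using this
  · rintro z ⟨hz, hz0⟩ hzU
    have hd := Submodule.range_ker_disjoint hn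
    rw [Submodule.ker_mkQ, Submodule.disjoint_def] at hd
    exact hz0 (hd z hz hzU)

/-- A finite-dimensional subspace disjoint from `U = ⋃ r, range (T r)` extends to a closed subspace
of dimension the continuum that is disjoint from `U`. -/
theorem exists_isClosed_rank_eq_continuum_disjoint [CompleteSpace V] {E : ℕ → Type*}
    [∀ r, NormedAddCommGroup (E r)] [∀ r, NormedSpace 𝕜 (E r)] [∀ r, CompleteSpace (E r)]
    (T : ∀ r, E r →L[𝕜] V) (U : Submodule 𝕜 V) (hU : (U : Set V) = ⋃ r, ((T r).range : Set V))
    (b : ℕ → V) (hb : LinearIndependent 𝕜 (U.mkQ ∘ b)) (A : Submodule 𝕜 V)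
    [FiniteDimensional 𝕜 A] (hA : Disjoint A U) :
    ∃ F : Submodule 𝕜 V, Module.rank 𝕜 F = Cardinal.continuum ∧ IsClosed (F : Set V) ∧ A ≤ F ∧
      Disjoint F U := by
  have hTU : ∀ r e, T r e ∈ U := fun r e => by
    rw [← SetLike.mem_coe, hU]
    exact mem_iUnion.2 ⟨r, e, rfl⟩
  let X := (Submodule.span 𝕜 (range b) ⊔ A).topologicalClosure
  have hXc : IsClosed (X : Set V) := Submodule.isClosed_topologicalClosure _
  have hAX : A ≤ X := le_sup_right.trans (Submodule.le_topologicalClosure _)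
  have hbX : ∀ n, b n ∈ X := fun n => Submodule.le_topologicalClosure _
    (le_sup_left (a := Submodule.span 𝕜 (range b)) (Submodule.subset_span (mem_range_self n)))
  have : CompleteSpace X := hXc.completeSpace_coe
  have : TopologicalSpace.SeparableSpace X := by
    obtain ⟨s, hs⟩ : A.FG := Module.Finite.iff_fg.1 inferInstance
    have hX : X = (Submodule.span 𝕜 (range b ∪ (s : Set V))).topologicalClosure := by
      rw [Submodule.span_union, hs]
    have hsep : TopologicalSpace.IsSeparable (X : Set V) := by
      rw [hX, Submodule.topologicalClosure_coe, TopologicalSpace.isSeparable_closure]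
      exact (((countable_range b).union s.countable_toSet).isSeparable).span
    exact hsep.separableSpace
  let D : ∀ r, Submodule 𝕜 (E r) := fun r => X.comap (T r).toLinearMap
  have : ∀ r, CompleteSpace (D r) := fun r =>
    (hXc.preimage (T r).continuous).completeSpace_coe
  have : CompleteSpace A := FiniteDimensional.complete 𝕜 A
  -- With `A` included in the range, avoiding it rules out `w + a = T r e` unless `w = 0`.
  let S : ∀ r, (D r × A) →L[𝕜] X := fun r =>
    (((T r).comp (D r).subtypeL).codRestrict X fun e => e.2).coprod
      (A.subtypeL.codRestrict X fun a => hAX a.2)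
  have hSne : ∀ r (G : Submodule 𝕜 X), FiniteDimensional 𝕜 G → (S r).range ⊔ G ≠ ⊤ := by
    intro r G _ htop
    -- Finite codimension would place all the independent classes of `b n` in this
    -- finite-dimensional space.
    let Q := (A ⊔ G.map X.subtype).map U.mkQ
    have hmem : ∀ n, U.mkQ (b n) ∈ Q := by
      intro n
      have hn : (⟨b n, hbX n⟩ : X) ∈ (S r).range ⊔ G := htop ▸ Submodule.mem_top
      obtain ⟨_, ⟨⟨e, a⟩, rfl⟩, g, hg, hsum⟩ := Submodule.mem_sup.1 hn
      have hbn : T r e + a + g = b n := congrArg Subtype.val hsum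
      refine ⟨a + g, Submodule.add_mem_sup a.2 (Submodule.mem_map_of_mem hg), ?_⟩
      rw [← hbn, add_assoc, map_add _ (T r e), show U.mkQ (T r e) = 0 from
        (Submodule.Quotient.mk_eq_zero U).2 (hTU r e), zero_add]
    have hli : LinearIndependent 𝕜 fun n => (⟨U.mkQ (b n), hmem n⟩ : Q) :=
      LinearIndependent.of_comp Q.subtype hb
    have := hli.finite
    exact not_finite ℕ
  obtain ⟨F, hFc, hFr, hFd⟩ := exists_isClosed_disjoint_range S hSne
  have hFX : F.map X.subtype ≤ X := Submodule.map_subtype_le X F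
  refine ⟨F.map X.subtype ⊔ A, le_antisymm ?_ ?_, ?_, le_sup_right, ?_⟩
  · calc Module.rank 𝕜 ↥(F.map X.subtype ⊔ A) ≤ Module.rank 𝕜 X :=
          Submodule.rank_mono (sup_le hFX hAX)
      _ ≤ Cardinal.mk X := rank_le_card 𝕜 X
      _ ≤ Cardinal.continuum := cardinalMk_le_continuum_of_separableSpace X
  · calc Cardinal.continuum ≤ Module.rank 𝕜 F := hFr
      _ = Module.rank 𝕜 (F.map X.subtype) :=
          (Submodule.equivMapOfInjective X.subtype X.injective_subtype F).rank_eq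
      _ ≤ _ := Submodule.rank_mono le_sup_left
  · refine Submodule.isClosed_sup_finiteDimensional _ _ ?_
    rw [Submodule.map_coe]
    exact hXc.isClosedEmbedding_subtypeVal.isClosedMap _ hFc
  · rw [Submodule.disjoint_def]
    intro z hz hzU
    obtain ⟨_, ⟨w, hw, rfl⟩, a, ha, rfl⟩ := Submodule.mem_sup.1 hz
    rw [← SetLike.mem_coe, hU] at hzU
    obtain ⟨r, e, he⟩ := mem_iUnion.1 hzU
    have he' : T r e = w + a := he
    have heX : T r e ∈ X := by
      rw [he']
      exact X.add_mem w.2 (hAX ha)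
    have hwS : w ∈ (S r).range := by
      refine ⟨(⟨e, heX⟩, ⟨-a, A.neg_mem ha⟩), Subtype.ext ?_⟩
      change T r e + -a = w
      rw [he', add_neg_cancel_right]
    have hw0 : w = 0 := Submodule.disjoint_def.1 (hFd r) w hw hwS
    subst hw0
    have haU : a ∈ U := by
      have := hTU r e
      rw [he'] at this
      simpa using this
    simp [Submodule.disjoint_def.1 hA a ha haU]

end Reduction

theorem theorem2p4 {𝕜 V : Type*} [RCLike 𝕜] [NormedAddCommGroup V] [NormedSpace 𝕜 V]
    [CompleteSpace V] (W : ℕ → Submodule 𝕜 V)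
    (U : Submodule 𝕜 V) (hU : (U : Set V) = ⋃ r, (W r : Set V))
    (hcodim : ¬ FiniteDimensional 𝕜 (V ⧸ U))
    (hW : ∀ r, ∃ (p : Seminorm 𝕜 (W r)) (C : ℝ), 0 < C ∧ IsBanachNorm p ∧
      ∀ x : W r, ‖(x : V)‖ ≤ C * p x) :
    ∀ α : Cardinal, α < Cardinal.aleph0 →
      IsPairSpaceable 𝕜 α Cardinal.continuum (⋃ r, (W r : Set V))ᶜ := by
  intro α hα
  rw [← hU]
  obtain ⟨b, hb⟩ := exists_seq_linearIndependent_mkQ U hcodim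
  refine ⟨?_, fun A hrank hsub => ?_⟩
  · obtain ⟨n, rfl⟩ := Cardinal.lt_aleph0.1 hα
    exact isLineable_compl_of_linearIndependent_mkQ U b hb n
  have : FiniteDimensional 𝕜 A := Module.rank_lt_aleph0_iff.1 (hrank ▸ hα)
  have hA : Disjoint A U := Submodule.disjoint_def.2 fun z hz hzU =>
    (hsub hz).resolve_left fun h => h hzU
  have hE : ∀ r, ∃ (E : Type _) (_ : NormedAddCommGroup E) (_ : NormedSpace 𝕜 E)
      (_ : CompleteSpace E) (T : E →L[𝕜] V), T.range = W r := fun r => by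
    obtain ⟨p, C, _, hp, hC⟩ := hW r
    exact exists_range_eq_of_isBanachNorm (W r) p C hp hC
  choose E _ _ _ T hT using hE
  obtain ⟨F, hF, hFc, hAF, hFU⟩ := exists_isClosed_rank_eq_continuum_disjoint T U
    (by simp only [hU, hT]) b hb A hA
  refine ⟨F, hF, hFc, hAF, fun z hz => ?_⟩
  by_cases hzU : z ∈ U
  · exact Or.inr (Submodule.disjoint_def.1 hFU z hz hzU)
  · exact Or.inl hzU
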